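/- Call a finite list of complex numbers realisable if it is the spectrum (eigenvalues counted with algebraic multiplicity, in any order) of a square matrix with nonnegative real entries. The Perron eigenvalue of a realisable list is its largest modulus $\max_i|\lambda_i|$, which is itself an entry of the list. Let $m\ge 2$ and let $(\rho,\lambda_2,\lambda_3,\ldots,\lambda_m)$ be a realisable list, where $\rho$ is its Perron eigenvalue, $\lambda_2$ is real and $\rho\neq\lambda_2$. Let $n\ge 2$, let $b_1$ be any real number such that $$\gamma:=\frac{\rho+\lambda_2-b_1}{2}\ \ge\ 0,$$ let $$b_2:=\frac{(\rho-\lambda_2)^2-b_1^2}{4},$$ and let $b_3,b_4,\ldots,b_n$ be any nonnegative real numbers. Then the list $$(\mu_1,\mu_2,\ldots,\mu_n,\lambda_3,\lambda_4,\ldots,\lambda_m)$$ is realisable, where $\mu_1,\ldots,\mu_n$ are the complex roots, counted with multiplicity, of the polynomial $$w(x):=(x-\gamma)^n-b_1(x-\gamma)^{n-1}-b_2(x-\gamma)^{n-2}-\cdots-b_{n-1}(x-\gamma)-b_n.$$ -/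

import Mathlib

open Polynomial

/-- A list of complex numbers, considered up to order, is realisable if it is the spectrum (with
algebraic multiplicities) of a square matrix with nonnegative real entries. -/
def Realisable (σ : Multiset ℂ) : Prop :=
  ∃ (k : ℕ) (A : Matrix (Fin k) (Fin k) ℝ), (∀ i j, 0 ≤ A i j) ∧ A.charpoly.aroots ℂ = σ

/-- `ρ` is the Perron eigenvalue of a list: it is an entry of the list and equals the largest
modulus of an entry, i.e. the spectral radius of a matrix with this spectrum. -/
def IsPerronEigenvalue (ρ : ℝ) (σ : Multiset ℂ) : Prop :=
  (ρ : ℂ) ∈ σ ∧ ∀ z ∈ σ, ‖z‖ ≤ ρ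

/-- The polynomial
`w(x) = (x - γ)^n - b₁ (x - γ)^(n-1) - b₂ (x - γ)^(n-2) - ⋯ - bₙ`
(only the values `b 1, …, b n` are used). -/
noncomputable def shiftedCompanionPoly (n : ℕ) (γ : ℝ) (b : ℕ → ℝ) : ℝ[X] :=
  (X - C γ) ^ n - ∑ k ∈ Finset.Icc 1 n, C (b k) * (X - C γ) ^ (n - k)

/-! By diagonal scaling by a Perron vector and a limit, the list is the spectrum of some `A ≥ 0`
with all row sums `ρ`, so the all-ones vector is a `ρ`-eigenvector. Let `s` be a `lam₂`-eigenvector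
whose largest entry `s i` is positive. Then `p = s i • 1 - s` is nonnegative and lies in the span of
the two eigenvectors, so entry `i` of `(x - A)⁻¹ p` is `c / ((x - ρ)(x - lam₂))` with `c = s i * (ρ
- lam₂) > 0`. Bordering `A` by a Jordan block at `γ` of size `n - 2`, coupled through `p` and
through the `b k / c` (`k ≥ 3`), replaces the factor `(x - ρ)(x - lam₂) = (x - γ)² - b₁(x - γ) - b₂`
of the characteristic polynomial by `w`. -/

open Matrix Filter Topology

/-! ### Perron vectors and constant row sums -/

/-- A matrix with positive entries has a positive eigenvector. -/
theorem exists_pos_eigenvector {ι : Type*} [Fintype ι] [Nonempty ι]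
    (B : Matrix ι ι ℝ) (hB : ∀ i j, 0 < B i j) :
    ∃ (v : ι → ℝ) (r : ℝ), (∀ i, 0 < v i) ∧ B *ᵥ v = r • v := by
  classical
  have hpos : ∀ y : ι → ℝ, (∀ i, 0 ≤ y i) → y ≠ 0 → ∀ i, 0 < (B *ᵥ y) i := by
    intro y hy hne i
    obtain ⟨j, hj⟩ := Function.ne_iff.mp hne
    refine Finset.sum_pos' (fun l _ => mul_nonneg (hB i l).le (hy l)) ⟨j, Finset.mem_univ _, ?_⟩
    exact mul_pos (hB i j) (lt_of_le_of_ne (hy j) (Ne.symm hj))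
  set T : ℝ := ∑ i, ∑ j, B i j with hT
  -- Collatz–Wielandt: maximise `t` subject to `t x ≤ B x` on the simplex; the cap `T` costs nothing
  -- and gives compactness.
  let K : Set ((ι → ℝ) × ℝ) :=
    (stdSimplex ℝ ι ×ˢ Set.Icc 0 T) ∩ {q | ∀ i, q.2 * q.1 i ≤ (B *ᵥ q.1) i}
  have hK : IsCompact K := by
    refine ((isCompact_stdSimplex ℝ ι).prod isCompact_Icc).inter_right ?_
    simp only [Set.ofPred_forall]
    refine isClosed_iInter fun i => isClosed_le (by fun_prop) ?_
    simp only [mulVec, dotProduct]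
    fun_prop
  have hTbound : ∀ x ∈ stdSimplex ℝ ι, ∀ t : ℝ, (∀ i, t * x i ≤ (B *ᵥ x) i) → t ≤ T := by
    intro x hx t ht
    calc t = ∑ i, t * x i := by rw [← Finset.mul_sum, hx.2, mul_one]
      _ ≤ ∑ i, (B *ᵥ x) i := Finset.sum_le_sum fun i _ => ht i
      _ ≤ T := by
        refine Finset.sum_le_sum fun i _ => Finset.sum_le_sum fun j _ => ?_
        have : x j ≤ 1 := by
          rw [← hx.2]
          exact Finset.single_le_sum (fun l _ => hx.1 l) (Finset.mem_univ j)
        nlinarith [hB i j]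
  have hne : K.Nonempty := by
    obtain ⟨i⟩ := ‹Nonempty ι›
    have hx := single_mem_stdSimplex ℝ i
    refine ⟨(Pi.single i 1, 0), ⟨hx, ?_⟩, ?_⟩
    · exact ⟨le_rfl, Finset.sum_nonneg fun i _ => Finset.sum_nonneg fun j _ => (hB i j).le⟩
    · intro l
      simpa using (hB l i).le
  obtain ⟨⟨x, t⟩, ⟨⟨hx, ht⟩, hle⟩, hmax⟩ := hK.exists_isMaxOn hne continuous_snd.continuousOn
  simp only [Set.mem_ofPred_eq] at hle hx ht
  have hx0 : x ≠ 0 := by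
    rintro rfl
    simpa using hx.2
  have heq : B *ᵥ x = t • x := by
    by_contra hcon
    have hy : ∀ i, 0 < (B *ᵥ x) i := hpos x hx.1 hx0
    -- If `B x ≠ t x`, applying `B` makes the inequality strict everywhere, so normalised `B x`
    -- admits a larger `t`.
    have hz : ∀ i, 0 < (B *ᵥ (B *ᵥ x - t • x)) i := by
      refine hpos _ (fun i => ?_) (sub_ne_zero.mpr hcon)
      simpa using hle i
    set y := B *ᵥ x with hydef
    have hz' : ∀ i, t * y i < (B *ᵥ y) i := by
      intro i
      have := hz i
      rw [mulVec_sub, mulVec_smul, ← hydef] at this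
      simpa using this
    obtain ⟨i₀, hi₀⟩ := Finite.exists_min fun i => (B *ᵥ y) i / y i
    set t' := (B *ᵥ y) i₀ / y i₀
    have htt' : t < t' := (lt_div_iff₀ (hy i₀)).mpr (hz' i₀)
    have hS : 0 < ∑ i, y i := Finset.sum_pos (fun i _ => hy i) Finset.univ_nonempty
    have hmem : (∑ i, y i)⁻¹ • y ∈ stdSimplex ℝ ι := by
      refine ⟨fun i => ?_, ?_⟩
      · have := hy i
        simp only [Pi.smul_apply, smul_eq_mul]
        positivity
      · simp only [Pi.smul_apply, smul_eq_mul, ← Finset.mul_sum]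
        exact inv_mul_cancel₀ hS.ne'
    have hle' : ∀ i, t' * ((∑ i, y i)⁻¹ • y) i ≤ (B *ᵥ ((∑ i, y i)⁻¹ • y)) i := by
      intro i
      rw [mulVec_smul]
      simp only [Pi.smul_apply, smul_eq_mul]
      rw [mul_left_comm]
      exact mul_le_mul_of_nonneg_left ((le_div_iff₀ (hy i)).mp (hi₀ i)) (inv_nonneg.mpr hS.le)
    have := hmax (show ((∑ i, y i)⁻¹ • y, t') ∈ K from
      ⟨⟨hmem, ht.1.trans htt'.le, hTbound _ hmem _ hle'⟩, hle'⟩)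
    exact absurd htt' (not_lt.mpr this)
  refine ⟨x, t, fun i => ?_, heq⟩
  have h1 : 0 < t * x i := by
    have := hpos x hx.1 hx0 i
    rwa [heq] at this
  exact pos_of_mul_pos_right h1 ht.1

/-- Diagonal scaling turns a positive matrix into one with constant row sums. -/
theorem exists_constant_rowSum_of_pos {ι : Type*} [Fintype ι] [DecidableEq ι] [Nonempty ι]
    (B : Matrix ι ι ℝ) (hB : ∀ i j, 0 < B i j) :
    ∃ (B' : Matrix ι ι ℝ) (r : ℝ), (∀ i j, 0 ≤ B' i j) ∧ B'.charpoly = B.charpoly ∧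
      (∀ i, ∑ j, B' i j = r) ∧ r ≤ ∑ i, ∑ j, B i j := by
  obtain ⟨v, r, hv, hr⟩ := exists_pos_eigenvector B hB
  have hunit : IsUnit (diagonal v) := by
    rw [isUnit_diagonal, Pi.isUnit_iff]
    exact fun i => (hv i).ne'.isUnit
  have hrv : ∀ i, ∑ j, B i j * v j = r * v i := fun i => congrFun hr i
  refine ⟨diagonal v⁻¹ * B * diagonal v, r, fun i j => ?_, ?_, fun i => ?_, ?_⟩
  · rw [mul_diagonal, diagonal_mul]
    exact mul_nonneg (mul_nonneg (inv_nonneg.mpr (hv i).le) (hB i j).le) (hv j).le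
  · rw [Matrix.charpoly_mul_comm, ← Matrix.mul_assoc, diagonal_mul_diagonal]
    simp [(hv _).ne']
  · simp only [mul_diagonal, diagonal_mul, mul_assoc, ← Finset.mul_sum, hrv]
    have := (hv i).ne'
    simp only [Pi.inv_apply]
    field_simp
  -- This bound on `r` later keeps the scaled matrices in a compact box.
  · obtain ⟨i, hi⟩ := Finite.exists_max v
    calc r ≤ ∑ j, B i j := by
          refine le_of_mul_le_mul_right ?_ (hv i)
          rw [← hrv, Finset.sum_mul]
          exact Finset.sum_le_sum fun j _ => mul_le_mul_of_nonneg_left (hi j) (hB i j).le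
      _ ≤ _ := Finset.single_le_sum (f := fun i => ∑ j, B i j)
          (fun l _ => Finset.sum_nonneg fun j _ => (hB l j).le) (Finset.mem_univ i)

theorem continuous_eval_charpoly {ι : Type*} [Fintype ι] [DecidableEq ι] (x : ℝ) :
    Continuous fun M : Matrix ι ι ℝ => M.charpoly.eval x := by
  simp only [Matrix.eval_charpoly]
  exact (continuous_const.sub continuous_id).matrix_det

/-- Every nonnegative matrix is cospectral to a nonnegative matrix with constant row sums. -/
theorem exists_constant_rowSum {ι : Type*} [Fintype ι] [DecidableEq ι] [Nonempty ι]
    (A : Matrix ι ι ℝ) (hA : ∀ i j, 0 ≤ A i j) :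
    ∃ (A' : Matrix ι ι ℝ) (r : ℝ), (∀ i j, 0 ≤ A' i j) ∧ A'.charpoly = A.charpoly ∧
      ∀ i, ∑ j, A' i j = r := by
  -- The scalings may degenerate as `ε → 0`, so the limit is only cospectral to `A`, not necessarily
  -- similar.
  let ε : ℕ → ℝ := fun k => 1 / ((k : ℝ) + 1)
  let J : Matrix ι ι ℝ := Matrix.of fun _ _ => 1
  have hε : ∀ k, 0 < ε k := fun k => by positivity
  have hε1 : ∀ k, ε k ≤ 1 := fun k => by
    rw [div_le_one (by positivity)]
    linarith [(Nat.cast_nonneg k : (0 : ℝ) ≤ k)]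
  have hlim : Tendsto (fun k => A + ε k • J) atTop (𝓝 A) := by
    simpa [ε] using (tendsto_const_nhds (x := A)).add
      ((tendsto_one_div_add_atTop_nhds_zero_nat (𝕜 := ℝ)).smul_const J)
  have hposk : ∀ k i j, 0 < (A + ε k • J) i j := fun k i j => by
    simpa [J] using add_pos_of_nonneg_of_pos (hA i j) (hε k)
  choose B r hB0 hBc hBr hr using fun k => exists_constant_rowSum_of_pos _ (hposk k)
  set T : ℝ := ∑ i, ∑ j, (A i j + 1)
  have hBT : ∀ k i j, B k i j ≤ T := fun k i j => by
    calc B k i j ≤ ∑ j, B k i j := Finset.single_le_sum (fun l _ => hB0 k i l) (Finset.mem_univ j)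
      _ = r k := hBr k i
      _ ≤ _ := hr k
      _ ≤ T := Finset.sum_le_sum fun i _ => Finset.sum_le_sum fun j _ => by simpa [J] using hε1 k
  have hcomp : IsCompact (Set.pi Set.univ fun _ : ι => Set.pi Set.univ fun _ : ι => Set.Icc 0 T) :=
    isCompact_univ_pi fun _ => isCompact_univ_pi fun _ => isCompact_Icc
  obtain ⟨A', hA', φ, hφ, hconv⟩ :=
    hcomp.tendsto_subseq (x := fun k i j => B k i j) fun k i _ j _ => ⟨hB0 k i j, hBT k i j⟩
  have hentry : ∀ i j, Tendsto (fun k => B (φ k) i j) atTop (𝓝 (A' i j)) := fun i j =>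
    tendsto_pi_nhds.mp (tendsto_pi_nhds.mp hconv i) j
  have hrow : ∀ i, Tendsto (fun k => r (φ k)) atTop (𝓝 (∑ j, A' i j)) := fun i => by
    simpa only [hBr] using tendsto_finsetSum Finset.univ fun j _ => hentry i j
  obtain ⟨i₀⟩ := ‹Nonempty ι›
  refine ⟨Matrix.of A', ∑ j, A' i₀ j, fun i j => (hA' i trivial j trivial).1, ?_,
    fun i => tendsto_nhds_unique (hrow i) (hrow i₀)⟩
  refine Polynomial.funext fun x => ?_
  have h1 : Tendsto (fun k => (B (φ k)).charpoly.eval x) atTop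
      (𝓝 ((Matrix.of A').charpoly.eval x)) :=
    ((continuous_eval_charpoly x).tendsto (Matrix.of A')).comp hconv
  have h2 : Tendsto (fun k => (B (φ k)).charpoly.eval x) atTop (𝓝 (A.charpoly.eval x)) := by
    simp only [hBc]
    exact ((continuous_eval_charpoly x).tendsto A).comp (hlim.comp hφ.tendsto_atTop)
  exact tendsto_nhds_unique h1 h2

/-- Eigenvalues of a nonnegative matrix with constant row sums `r` have modulus at most `r`. -/
theorem norm_le_of_mem_aroots_charpoly {ι : Type*} [Fintype ι] [DecidableEq ι]
    (A : Matrix ι ι ℝ) (hA : ∀ i j, 0 ≤ A i j) {r : ℝ} (hr : ∀ i, ∑ j, A i j = r)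
    {z : ℂ} (hz : z ∈ A.charpoly.aroots ℂ) : ‖z‖ ≤ r := by
  have hz' : ((A.map (algebraMap ℝ ℂ)).charpoly).eval z = 0 := by
    rw [Matrix.charpoly_map, eval_map_algebraMap]
    exact (mem_aroots.mp hz).2
  rw [Matrix.eval_charpoly] at hz'
  obtain ⟨v, hv, h⟩ := Matrix.exists_mulVec_eq_zero_iff.mpr hz'
  obtain ⟨j₀, hj₀⟩ := Function.ne_iff.mp hv
  have : Nonempty ι := ⟨j₀⟩
  obtain ⟨i, hi⟩ := Finite.exists_max fun i => ‖v i‖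
  have hvi : 0 < ‖v i‖ := (norm_pos_iff.mpr hj₀).trans_le (hi j₀)
  have hzi : z * v i = ∑ j, (A i j : ℂ) * v j := by
    have := congrFun h i
    rw [sub_mulVec, scalar_apply] at this
    simpa [mulVec_diagonal, mulVec, dotProduct, sub_eq_zero] using this
  refine le_of_mul_le_mul_right ?_ hvi
  calc ‖z‖ * ‖v i‖ = ‖∑ j, (A i j : ℂ) * v j‖ := by rw [← norm_mul, hzi]
    _ ≤ ∑ j, ‖(A i j : ℂ) * v j‖ := norm_sum_le _ _
    _ ≤ ∑ j, A i j * ‖v i‖ := Finset.sum_le_sum fun j _ => by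
        rw [norm_mul, Complex.norm_real, Real.norm_of_nonneg (hA i j)]
        exact mul_le_mul_of_nonneg_left (hi j) (hA i j)
    _ = r * ‖v i‖ := by rw [← Finset.sum_mul, hr]

/-! ### Bordering by a Jordan block -/

/-- Bordering `A` with a rank-one coupling to `D`: the determinant is governed by `u`, `z` with
`A u = p` and `z D = e`. -/
theorem det_fromBlocks_vecMulVec {ι κ : Type*} [Fintype ι] [DecidableEq ι] [Fintype κ]
    [DecidableEq κ] (A : Matrix ι ι ℝ) (D : Matrix κ κ ℝ) (p q u : ι → ℝ) (e β z : κ → ℝ)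
    (hu : A *ᵥ u = p) (hz : z ᵥ* D = e) :
    (fromBlocks A (-vecMulVec p e) (-vecMulVec β q) D).det =
      A.det * (1 - (z ⬝ᵥ β) * (q ⬝ᵥ u)) * D.det := by
  -- A Schur complement in which `z` and `u` stand in for `e D⁻¹` and `A⁻¹ p`, so neither block need
  -- be invertible.
  have hfac : fromBlocks A (-vecMulVec p e) (-vecMulVec β q) D =
      fromBlocks 1 (-vecMulVec p z) 0 1 *
        fromBlocks (A * (1 + vecMulVec (-((z ⬝ᵥ β) • u)) q)) 0 (-vecMulVec β q) D := by
    rw [fromBlocks_multiply]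
    congr 1
    · ext i j
      simp [Matrix.mul_add, mul_vecMulVec, mulVec_neg, mulVec_smul, hu, vecMulVec_apply,
        ← neg_vecMulVec, vecMulVec_mulVec]
      ring
    · simp [vecMulVec_mul, hz]
    · simp
    · simp
  rw [hfac, det_mul, det_fromBlocks_zero₂₁, det_fromBlocks_zero₁₂, det_mul,
    vecMulVec_eq Unit, det_one_add_replicateCol_mul_replicateRow]
  simp [dotProduct_neg, dotProduct_smul]
  left; left; ring

/-- The Jordan block of size `d` with eigenvalue `γ`. -/
def jordanBlock (d : ℕ) (γ : ℝ) : Matrix (Fin d) (Fin d) ℝ :=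
  Matrix.of fun i j => if i = j then γ else if i.val + 1 = j.val then 1 else 0

theorem det_scalar_sub_jordanBlock (d : ℕ) (γ x : ℝ) :
    (scalar (Fin d) x - jordanBlock d γ).det = (x - γ) ^ d := by
  rw [det_of_isUpperTriangular]
  · simp [jordanBlock]
  · intro i j hij
    have h1 : i ≠ j := ne_of_gt hij
    have h2 : i.val + 1 ≠ j.val := by
      have : j.val < i.val := hij
      omega
    simp [jordanBlock, h1, h2]

/-- Gives the first row of the resolvent of the Jordan block, used as `z` in the bordered
determinant. -/
theorem vecMul_scalar_sub_jordanBlock (d : ℕ) {γ x : ℝ} (hx : x - γ ≠ 0) :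
    (fun j : Fin d => ((x - γ) ^ (j.val + 1))⁻¹) ᵥ* (scalar (Fin d) x - jordanBlock d γ) =
      fun j => if j.val = 0 then 1 else 0 := by
  ext j
  have hterm : ∀ i : Fin d, ((x - γ) ^ (i.val + 1))⁻¹ * (scalar (Fin d) x - jordanBlock d γ) i j =
      (if i = j then ((x - γ) ^ j.val)⁻¹ else 0) -
        if i.val + 1 = j.val then ((x - γ) ^ j.val)⁻¹ else 0 := by
    intro i
    by_cases h : i = j
    · subst h
      simp [jordanBlock]
      field_simp
      ring
    · by_cases h' : i.val + 1 = j.val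
      · simp [jordanBlock, h, h', Matrix.diagonal]
      · simp [jordanBlock, h, h', Matrix.diagonal]
  simp only [vecMul, dotProduct, hterm, Finset.sum_sub_distrib, Finset.sum_ite_eq',
    Finset.mem_univ, if_true]
  rcases Nat.eq_zero_or_pos j.val with h0 | hpos
  · simp [h0]
  · rw [Finset.sum_eq_single ⟨j.val - 1, by omega⟩]
    · simp [Nat.sub_add_cancel hpos, hpos.ne']
    · intro i _ hi
      rw [if_neg]
      intro h
      exact hi (Fin.ext (by simp; omega))
    · simp

theorem eval_shiftedCompanionPoly_add_two (d : ℕ) (b : ℕ → ℝ) (γ x : ℝ) (hx : x - γ ≠ 0) :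
    (shiftedCompanionPoly (d + 2) γ b).eval x =
      (x - γ) ^ d * ((x - γ) ^ 2 - b 1 * (x - γ) - b 2 -
        ∑ j : Fin d, ((x - γ) ^ (j.val + 1))⁻¹ * b (j.val + 3)) := by
  have h1 : ∀ f : ℕ → ℝ, ∑ k ∈ Finset.Icc 1 (d + 2), f k =
      f 1 + f 2 + ∑ j : Fin d, f (j.val + 3) := by
    intro f
    rw [Fin.sum_univ_eq_sum_range (fun j => f (j + 3)), ← Finset.Ico_add_one_right_eq_Icc,
      Finset.sum_Ico_eq_sum_range, show d + 2 + 1 - 1 = d + 1 + 1 by omega,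
      Finset.sum_range_succ', Finset.sum_range_succ']
    simp only [add_comm, add_left_comm]
    norm_num
    ring
  simp only [shiftedCompanionPoly, eval_sub, eval_pow, eval_X, eval_C, eval_finsetSum, eval_mul, h1]
  rw [mul_sub, Finset.mul_sum]
  have h2 : ∀ j : Fin d, (x - γ) ^ d * (((x - γ) ^ (j.val + 1))⁻¹ * b (j.val + 3)) =
      b (j.val + 3) * (x - γ) ^ (d + 2 - (j.val + 3)) := by
    intro j
    have : (x - γ) ^ d = (x - γ) ^ (d + 2 - (j.val + 3)) * (x - γ) ^ (j.val + 1) := by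
      rw [← pow_add]
      congr 1
      omega
    rw [this]
    field_simp
  simp only [h2]
  rw [show d + 2 - 1 = d + 1 by omega, show d + 2 - 2 = d by omega]
  ring

/-- The roots `ρ, lam₂` of a nonnegative matrix with row sums `ρ` can be traded for those of
`shiftedCompanionPoly`. -/
theorem exists_nonneg_charpoly_mul_eq {ι : Type*} [Fintype ι] [DecidableEq ι] (A : Matrix ι ι ℝ)
    (hA : ∀ i j, 0 ≤ A i j) {ρ lam₂ : ℝ} (hlt : lam₂ < ρ) (hrow : ∀ i, ∑ j, A i j = ρ)
    (hroot : A.charpoly.eval lam₂ = 0) (d : ℕ) (b : ℕ → ℝ) {γ : ℝ} (hγ0 : 0 ≤ γ)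
    (hquad : ∀ x, (x - γ) ^ 2 - b 1 * (x - γ) - b 2 = (x - ρ) * (x - lam₂))
    (hb : ∀ k, 3 ≤ k → k ≤ d + 2 → 0 ≤ b k) :
    ∃ M : Matrix (ι ⊕ Fin d) (ι ⊕ Fin d) ℝ, (∀ i j, 0 ≤ M i j) ∧
      M.charpoly * ((X - C ρ) * (X - C lam₂)) = A.charpoly * shiftedCompanionPoly (d + 2) γ b := by
  rw [Matrix.eval_charpoly] at hroot
  obtain ⟨s, hs, i, hmax, hsi⟩ : ∃ s : ι → ℝ, A *ᵥ s = lam₂ • s ∧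
      ∃ i, (∀ j, s j ≤ s i) ∧ 0 < s i := by
    obtain ⟨s, hs0, hs⟩ := Matrix.exists_mulVec_eq_zero_iff.mpr hroot
    have hs' : A *ᵥ s = lam₂ • s := by
      rw [sub_mulVec, sub_eq_zero] at hs
      rw [← hs]
      ext i
      simp [scalar_apply, mulVec_diagonal]
    obtain ⟨j, hj⟩ := Function.ne_iff.mp hs0
    have : Nonempty ι := ⟨j⟩
    -- Passing to `-s` if necessary makes the largest entry positive.
    rcases lt_or_gt_of_ne hj with h | h
    · obtain ⟨i, hi⟩ := Finite.exists_max (-s)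
      exact ⟨-s, by rw [mulVec_neg, hs', smul_neg], i, hi, lt_of_lt_of_le (by simpa using h) (hi j)⟩
    · obtain ⟨i, hi⟩ := Finite.exists_max s
      exact ⟨s, hs', i, hi, lt_of_lt_of_le h (hi j)⟩
  have hone : A *ᵥ (fun _ => 1) = fun _ => ρ := by
    ext i
    simpa [mulVec, dotProduct] using hrow i
  set c := s i * (ρ - lam₂) with hc
  have hcpos : 0 < c := mul_pos hsi (sub_pos.mpr hlt)
  let p : ι → ℝ := fun j => s i - s j
  let q : ι → ℝ := Pi.single i 1
  let e : Fin d → ℝ := fun j => if j.val = 0 then 1 else 0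
  let β : Fin d → ℝ := fun j => b (j.val + 3) / c
  refine ⟨fromBlocks A (vecMulVec p e) (vecMulVec β q) (jordanBlock d γ), ?_, ?_⟩
  · have hp : ∀ j, 0 ≤ p j := fun j => sub_nonneg.mpr (hmax j)
    have hq : ∀ j, 0 ≤ q j := fun j => by
      simp only [q, Pi.single_apply]
      split_ifs <;> norm_num
    have he : ∀ j, 0 ≤ e j := fun j => by
      simp only [e]
      split_ifs <;> norm_num
    have hβ : ∀ j, 0 ≤ β j := fun j => div_nonneg (hb _ (by omega) (by omega)) hcpos.le
    rintro (j | j) (l | l)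
    · exact hA j l
    · exact mul_nonneg (hp j) (he l)
    · exact mul_nonneg (hβ j) (hq l)
    · simp only [fromBlocks_apply₂₂, jordanBlock, Matrix.of_apply]
      split_ifs <;> first | exact hγ0 | norm_num
  · refine Polynomial.eq_of_infinite_eval_eq _ _ (Set.Infinite.mono ?_
      (Set.Finite.infinite_compl (Set.toFinite {ρ, lam₂, γ})))
    intro x hx
    simp only [Set.mem_compl_iff, Set.mem_insert_iff, Set.mem_singleton_iff, not_or] at hx
    have hxρ := sub_ne_zero.mpr hx.1
    have hxl := sub_ne_zero.mpr hx.2.1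
    have hxγ := sub_ne_zero.mpr hx.2.2
    have hblocks : scalar (ι ⊕ Fin d) x -
        fromBlocks A (vecMulVec p e) (vecMulVec β q) (jordanBlock d γ) =
        fromBlocks (scalar ι x - A) (-vecMulVec p e) (-vecMulVec β q)
          (scalar (Fin d) x - jordanBlock d γ) := by
      ext (j | j) (l | l) <;> simp [Matrix.diagonal]
    -- The resolvent acts on each eigencomponent of `p` separately.
    let u : ι → ℝ := (s i / (x - ρ)) • (fun _ => 1) - (1 / (x - lam₂)) • s
    have hu : (scalar ι x - A) *ᵥ u = p := by
      rw [sub_mulVec, mulVec_sub A, mulVec_smul, mulVec_smul, hone, hs]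
      ext j
      simp [u, p, scalar_apply]
      field_simp
      ring
    show eval x _ = eval x _
    rw [eval_mul, Matrix.eval_charpoly, hblocks, det_fromBlocks_vecMulVec _ _ p q u e β _ hu
      (vecMul_scalar_sub_jordanBlock d hxγ), det_scalar_sub_jordanBlock, eval_mul, eval_mul (p := A.charpoly),
      eval_shiftedCompanionPoly_add_two d b γ x hxγ, hquad, Matrix.eval_charpoly]
    have hsum : (fun j : Fin d => ((x - γ) ^ (j.val + 1))⁻¹) ⬝ᵥ β =
        (∑ j : Fin d, ((x - γ) ^ (j.val + 1))⁻¹ * b (j.val + 3)) / c := by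
      simp only [dotProduct, β, Finset.sum_div, mul_div_assoc]
    have hqu : q ⬝ᵥ u = c / ((x - ρ) * (x - lam₂)) := by
      simp [q, u, hc]
      field_simp
      ring
    rw [hsum, hqu]
    simp only [eval_sub, eval_X, eval_C]
    have := hcpos.ne'
    clear_value c
    field_simp

theorem mainTheorem3 (ρ lam₂ : ℝ) (Λ : Multiset ℂ)
    (hreal : Realisable ((ρ : ℂ) ::ₘ (lam₂ : ℂ) ::ₘ Λ))
    (hperron : IsPerronEigenvalue ρ ((ρ : ℂ) ::ₘ (lam₂ : ℂ) ::ₘ Λ))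
    (hne : ρ ≠ lam₂)
    (n : ℕ) (hn : 2 ≤ n) (b : ℕ → ℝ) (γ : ℝ)
    (hγ : γ = (ρ + lam₂ - b 1) / 2) (hγ0 : 0 ≤ γ)
    (hb₂ : b 2 = ((ρ - lam₂) ^ 2 - b 1 ^ 2) / 4)
    (hb : ∀ k, 3 ≤ k → k ≤ n → 0 ≤ b k) :
    Realisable ((shiftedCompanionPoly n γ b).aroots ℂ + Λ) := by
  obtain ⟨k, A₀, hA₀, hspec₀⟩ := hreal
  obtain ⟨d, rfl⟩ := Nat.exists_eq_add_of_le' hn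
  have hk : Nonempty (Fin k) := by
    by_contra h
    rw [not_nonempty_iff] at h
    simp at hspec₀
  obtain ⟨A, r, hA, hchar, hrow⟩ := exists_constant_rowSum A₀ hA₀
  have hspec : A.charpoly.aroots ℂ = (ρ : ℂ) ::ₘ (lam₂ : ℂ) ::ₘ Λ := by rw [hchar, hspec₀]
  have hlam_le : lam₂ ≤ ρ := by
    have := hperron.2 lam₂ (by simp)
    rw [Complex.norm_real] at this
    exact (le_abs_self _).trans this
  have hroot : ∀ x : ℝ, (x : ℂ) ∈ A.charpoly.aroots ℂ ↔ A.charpoly.eval x = 0 := by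
    intro x
    have h := aeval_algebraMap_apply ℂ x A.charpoly
    rw [mem_aroots, ← Complex.coe_algebraMap, h, Polynomial.coe_aeval_eq_eval]
    simp [A.charpoly_monic.ne_zero]
  -- The row sum is an eigenvalue, hence at most `ρ`, and it bounds every eigenvalue, including `ρ`.
  have hrρ : r = ρ := by
    apply le_antisymm
    · have hr : (r : ℂ) ∈ A.charpoly.aroots ℂ := by
        rw [hroot, Matrix.eval_charpoly]
        refine Matrix.exists_mulVec_eq_zero_iff.mp ⟨fun _ => 1, ?_, ?_⟩
        · exact Function.ne_iff.mpr ⟨hk.some, one_ne_zero⟩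
        · ext i
          simp [scalar_apply, mulVec, dotProduct, hrow, diagonal_apply]
      have := hperron.2 r (hspec ▸ hr)
      rw [Complex.norm_real] at this
      exact (le_abs_self _).trans this
    · have := norm_le_of_mem_aroots_charpoly A hA hrow (z := ρ) (by simp [hspec])
      rw [Complex.norm_real] at this
      exact (le_abs_self _).trans this
  subst hrρ
  obtain ⟨M, hM, hMchar⟩ := exists_nonneg_charpoly_mul_eq A hA (lt_of_le_of_ne hlam_le hne.symm)
    hrow ((hroot lam₂).mp (by simp [hspec])) d b hγ0
    (fun x => by rw [hb₂, hγ]; ring) hb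
  have hquad : (X - C r) * (X - C lam₂) ≠ 0 := mul_ne_zero (X_sub_C_ne_zero _) (X_sub_C_ne_zero _)
  have hprod := mul_ne_zero M.charpoly_monic.ne_zero hquad
  refine ⟨k + d, M.reindex finSumFinEquiv finSumFinEquiv, fun i j => hM _ _, ?_⟩
  rw [Matrix.charpoly_reindex]
  have h := congrArg (fun f => f.aroots ℂ) hMchar
  rw [aroots_mul hprod, aroots_mul hquad, aroots_X_sub_C, aroots_X_sub_C, aroots_mul (hMchar ▸ hprod),
    hspec] at h
  have h' : M.charpoly.aroots ℂ + ({(r : ℂ)} + {(lam₂ : ℂ)}) =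
      (aroots (shiftedCompanionPoly (d + 2) γ b) ℂ + Λ) + ({(r : ℂ)} + {(lam₂ : ℂ)}) := by
    refine h.trans ?_
    simp only [← Multiset.singleton_add]
    abel
  exact add_right_cancel h'
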